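/- For an integer $n>1$ define $f=f_n:\{0,1\}^n\times\{0,1\}^n\to\{0,1\}$ by $f(x,y)=1$ iff $|x\wedge y|\neq 1$, where $x\wedge y$ is the bitwise AND and $|z|$ denotes the number of ones in $z$; let $\overline f=1-f$. A classical nondeterministic protocol for a function $g:\{0,1\}^n\times\{0,1\}^n\to\{0,1\}$ is a two-party communication protocol in which Alice receives $x$, Bob receives $y$, each player has a private random string (the two strings being independent), the players exchange bits according to a protocol tree whose leaves are labelled by the output bit (so both players know the output at the end), and the probability of output $1$ on input $(x,y)$ is positive if and only if $g(x,y)=1$. Its cost is the number of bits exchanged in the worst case, and $\mathrm{Ncc}(g)$ is the minimal cost of such a protocol for $g$. Then $\mathrm{Ncc}(f)\in\Omega(n)$, i.e. there are a constant $c>0$ and an $N$ such that $\mathrm{Ncc}(f_n)\ge c\,n$ for all $n>1$ with $n\geq N$; and $\mathrm{Ncc}(\overline{f})\ge n-1$ for every $n>1$. -/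

import Mathlib

/-- A two-party protocol tree. Alice holds an element of `U`, Bob an element of `V`. At an inner
node the owner of the node sends one bit, computed from what that player holds, and both players
move to the corresponding child (`zero` or `one`). A leaf carries the output bit, so the output is
determined by the transcript and is known to both players. -/
inductive ProtocolTree (U V : Type) : Type
  | leaf (out : Bool) : ProtocolTree U V
  | alice (bit : U → Bool) (zero one : ProtocolTree U V) : ProtocolTree U V
  | bob (bit : V → Bool) (zero one : ProtocolTree U V) : ProtocolTree U V

namespace ProtocolTree

variable {U V : Type}

/-- The output of the protocol when Alice holds `u` and Bob holds `v`. -/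
def run : ProtocolTree U V → U → V → Bool
  | leaf out, _, _ => out
  | alice bit zero one, u, v => if bit u then one.run u v else zero.run u v
  | bob bit zero one, u, v => if bit v then one.run u v else zero.run u v

/-- The height of the tree: the number of bits exchanged in the worst case. -/
def height : ProtocolTree U V → ℕ
  | leaf _ => 0
  | alice _ zero one => max zero.height one.height + 1
  | bob _ zero one => max zero.height one.height + 1

end ProtocolTree

/-- A classical randomized (private-coin) protocol on inputs from `X` and `Y`: besides the inputs,
Alice and Bob each have a private random bit string of arbitrary length, drawn independently of
each other from fixed distributions. -/
structure RandomizedProtocol (X Y : Type) where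
  /-- Distribution of Alice's random string. -/
  coinsA : PMF (List Bool)
  /-- Distribution of Bob's random string. -/
  coinsB : PMF (List Bool)
  /-- The protocol run on the inputs together with the random strings. -/
  tree : ProtocolTree (X × List Bool) (Y × List Bool)

namespace RandomizedProtocol

variable {X Y : Type}

/-- The distribution of the output bit on input `(x, y)`. -/
noncomputable def outputDist (P : RandomizedProtocol X Y) (x : X) (y : Y) : PMF Bool :=
  P.coinsA.bind fun r => P.coinsB.bind fun s => PMF.pure (P.tree.run (x, r) (y, s))

/-- The acceptance probability on input `(x, y)`. -/
noncomputable def acceptProb (P : RandomizedProtocol X Y) (x : X) (y : Y) : ENNReal :=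
  P.outputDist x y true

/-- The communication cost: the number of bits exchanged in the worst case. -/
def cost (P : RandomizedProtocol X Y) : ℕ := P.tree.height

/-- `P` is a nondeterministic protocol for `f`: its acceptance probability on `(x, y)` is positive
if and only if `f x y = 1`. -/
def IsNondeterministicFor (P : RandomizedProtocol X Y) (f : X → Y → Bool) : Prop :=
  ∀ x y, 0 < P.acceptProb x y ↔ f x y = true

end RandomizedProtocol

/-- The classical nondeterministic communication complexity of `f`: the least cost of a
nondeterministic protocol for `f`. -/
noncomputable def Ncc {X Y : Type} (f : X → Y → Bool) : ℕ :=
  sInf {c | ∃ P : RandomizedProtocol X Y, P.IsNondeterministicFor f ∧ P.cost = c}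

/-- If Alice has finitely many inputs, nondeterministic protocols for `f` exist, so the infimum
in `Ncc` is a minimum. -/
theorem exists_isNondeterministicFor {X Y : Type} [Finite X] (f : X → Y → Bool) :
    ∃ P : RandomizedProtocol X Y, P.IsNondeterministicFor f := by
  classical
  have key : ∀ L : List X, ∃ T : ProtocolTree (X × List Bool) (Y × List Bool),
      ∀ x ∈ L, ∀ r y s, T.run (x, r) (y, s) = f x y := by
    intro L
    induction L with
    | nil => exact ⟨.leaf false, by simp⟩
    | cons a L ih =>
      obtain ⟨T, hT⟩ := ih
      refine ⟨.alice (fun u => decide (u.1 = a)) T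
        (.bob (fun v => f a v.1) (.leaf false) (.leaf true)), ?_⟩
      intro x hx r y s
      by_cases h : x = a
      · subst h
        cases hf : f x y <;> simp [ProtocolTree.run, hf]
      · have hx' : x ∈ L := by simpa [h] using hx
        simpa [ProtocolTree.run, h] using hT x hx' r y s
  obtain ⟨L, hL⟩ : ∃ L : List X, ∀ x, x ∈ L := by
    haveI := Fintype.ofFinite X
    exact ⟨Finset.univ.toList, by simp⟩
  obtain ⟨T, hT⟩ := key L
  refine ⟨⟨PMF.pure [], PMF.pure [], T⟩, fun x y => ?_⟩
  simp only [RandomizedProtocol.acceptProb, RandomizedProtocol.outputDist, PMF.pure_bind,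
    hT x (hL x), PMF.pure_apply]
  cases f x y <;> simp

/-- The Hamming weight `|z|` of a bit string. -/
def weight {n : ℕ} (z : Fin n → Bool) : ℕ := (Finset.univ.filter fun i => z i = true).card

/-- The function `f(x, y) = 1` iff `|x ∧ y| ≠ 1`, with `x ∧ y` the bitwise AND. -/
def fNotOne (n : ℕ) (x y : Fin n → Bool) : Bool := decide (weight (fun i => x i && y i) ≠ 1)

/-- The complement of a Boolean function of two arguments. -/
def complementFn {X Y : Type} (f : X → Y → Bool) (x : X) (y : Y) : Bool := !(f x y)

/-!
The ones of a function with a nondeterministic protocol of cost `c` form a union of at most `2 ^ c`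
combinatorial rectangles: the leaves of the protocol tree give rectangles in the inputs together
with the random strings, and projecting the strings away keeps them rectangles because the strings
are independent. Hence a family of ones of which a rectangle of ones contains at most `b` members
has at most `2 ^ c * b` members.

For `f` take the `3 ^ n` disjoint pairs. A rectangle of ones `A × B` contains at most `2 ^ n` of
them (Kaibel and Weltge): if `A₀`, `A₁`, `B₀`, `B₁` are the sections of `A` and `B` at the first
bit, then no disjoint pair lies in `A₁ × B₁`, so the disjoint pairs of `A × B` are accounted for by
those of the rectangles of ones `(A₀ ∪ A₁) × B₀` and `A₀ × (B₀ ∪ B₁)` in one dimension less. Hence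
`c ≥ n log₂ (3 / 2)`. For the complement of `f` take the `2 ^ (n - 1)` pairs that share the first
coordinate and are complementary on the others. No two of them lie in a common rectangle of ones, so
`c ≥ n - 1`.
-/

/-- The set of ones of `f` is a union of `k` combinatorial rectangles `A i × B i`. Rectangles may
be empty or repeated, so that `k` is an upper bound on the number of rectangles needed. -/
def HasRectangleCover {X Y : Type*} (f : X → Y → Bool) (k : ℕ) : Prop :=
  ∃ (A : Fin k → Set X) (B : Fin k → Set Y), ∀ x y, f x y = true ↔ ∃ i, x ∈ A i ∧ y ∈ B i

theorem exists_fin_add_iff {m n : ℕ} {p : Fin (m + n) → Prop} :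
    (∃ i, p i) ↔ (∃ i, p (Fin.castAdd n i)) ∨ ∃ j, p (Fin.natAdd m j) := by
  simp [finSumFinEquiv.surjective.exists]

namespace HasRectangleCover

variable {X Y : Type*} {f g : X → Y → Bool} {k l : ℕ}

theorem swap (hf : HasRectangleCover f k) : HasRectangleCover (fun y x => f x y) k := by
  obtain ⟨A, B, hAB⟩ := hf
  exact ⟨B, A, fun y x => by simp only [hAB, and_comm]⟩

theorem mono (hf : HasRectangleCover f k) (hkl : k ≤ l) : HasRectangleCover f l := by
  obtain ⟨m, rfl⟩ := Nat.exists_eq_add_of_le hkl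
  obtain ⟨A, B, hAB⟩ := hf
  exact ⟨Fin.append A fun _ => ∅, Fin.append B fun _ => ∅, fun x y => by
    simp [hAB, exists_fin_add_iff]⟩

theorem ite_left (hf : HasRectangleCover f k) (hg : HasRectangleCover g l) (p : X → Bool) :
    HasRectangleCover (fun x y => if p x then f x y else g x y) (k + l) := by
  obtain ⟨A, B, hAB⟩ := hf
  obtain ⟨C, D, hCD⟩ := hg
  refine ⟨Fin.append (fun i => {x | p x = true} ∩ A i) fun i => {x | p x = false} ∩ C i,
    Fin.append B D, fun x y => ?_⟩
  cases hp : p x <;> simp [hp, hAB, hCD, exists_fin_add_iff]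

theorem ite_right (hf : HasRectangleCover f k) (hg : HasRectangleCover g l) (p : Y → Bool) :
    HasRectangleCover (fun x y => if p y then f x y else g x y) (k + l) :=
  (hf.swap.ite_left hg.swap p).swap

theorem card_le_mul {ι : Type*} [Fintype ι] (hf : HasRectangleCover f k) (x : ι → X) (y : ι → Y)
    (hone : ∀ i, f (x i) (y i) = true) (b : ℕ)
    (hrect : ∀ (A : Set X) (B : Set Y), (∀ u ∈ A, ∀ v ∈ B, f u v = true) →
      (x ⁻¹' A ∩ y ⁻¹' B).ncard ≤ b) :
    Fintype.card ι ≤ k * b := by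
  obtain ⟨A, B, hAB⟩ := hf
  choose r hr using fun i => (hAB (x i) (y i)).1 (hone i)
  have fiber_le (j : Fin k) : (r ⁻¹' {j}).ncard ≤ b := by
    refine (Set.ncard_le_ncard ?_).trans
      (hrect (A j) (B j) fun u hu v hv => (hAB u v).2 ⟨j, hu, hv⟩)
    rintro i rfl
    exact hr i
  classical
  calc Fintype.card ι ≤ b * (Finset.univ : Finset (Fin k)).card :=
        Finset.card_le_mul_card_image_of_maps_to (fun i _ => Finset.mem_univ (r i)) b fun j _ => by
          simpa [Set.ncard_eq_toFinset_card'] using fiber_le j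
    _ = k * b := by rw [Finset.card_fin, mul_comm]

theorem card_le_of_fooling {ι : Type*} [Fintype ι] (hf : HasRectangleCover f k) (x : ι → X)
    (y : ι → Y) (hone : ∀ i, f (x i) (y i) = true)
    (hfool : ∀ i j, f (x i) (y j) = true → f (x j) (y i) = true → i = j) :
    Fintype.card ι ≤ k := by
  rw [← mul_one k]
  refine hf.card_le_mul x y hone 1 fun A B hAB => (Set.ncard_le_one_iff (Set.toFinite _)).2 ?_
  rintro i j ⟨hxi, hyi⟩ ⟨hxj, hyj⟩
  exact hfool i j (hAB _ hxi _ hyj) (hAB _ hxj _ hyi)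

end HasRectangleCover

theorem ProtocolTree.hasRectangleCover {U V : Type} (T : ProtocolTree U V) :
    HasRectangleCover T.run (2 ^ T.height) := by
  have two_pow_add_le (a b : ℕ) : 2 ^ b + 2 ^ a ≤ 2 ^ (max a b + 1) := by
    rw [pow_succ, mul_two]
    gcongr <;> simp
  induction T with
  | leaf out => exact ⟨fun _ => {_u | out = true}, fun _ => Set.univ, by simp [run, height]⟩
  | alice bit zero one hzero hone => exact (hone.ite_left hzero bit).mono (two_pow_add_le _ _)
  | bob bit zero one hzero hone => exact (hone.ite_right hzero bit).mono (two_pow_add_le _ _)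

theorem RandomizedProtocol.acceptProb_pos_iff {X Y : Type} (P : RandomizedProtocol X Y) (x : X)
    (y : Y) : 0 < P.acceptProb x y ↔
      ∃ r ∈ P.coinsA.support, ∃ s ∈ P.coinsB.support, P.tree.run (x, r) (y, s) = true := by
  rw [acceptProb, pos_iff_ne_zero, ← PMF.mem_support_iff, outputDist]
  simp only [PMF.mem_support_bind_iff, PMF.mem_support_pure_iff, eq_comm]

theorem RandomizedProtocol.IsNondeterministicFor.hasRectangleCover {X Y : Type}
    {P : RandomizedProtocol X Y} {f : X → Y → Bool} (hP : P.IsNondeterministicFor f) :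
    HasRectangleCover f (2 ^ P.cost) := by
  obtain ⟨A, B, hAB⟩ := P.tree.hasRectangleCover
  refine ⟨fun i => {x | ∃ r ∈ P.coinsA.support, (x, r) ∈ A i},
    fun i => {y | ∃ s ∈ P.coinsB.support, (y, s) ∈ B i}, fun x y => ?_⟩
  rw [← hP x y, P.acceptProb_pos_iff]
  simp only [hAB, Set.mem_ofPred_eq]
  constructor
  · rintro ⟨r, hr, s, hs, i, hxr, hys⟩
    exact ⟨i, ⟨r, hr, hxr⟩, s, hs, hys⟩
  · rintro ⟨i, ⟨r, hr, hxr⟩, s, hs, hys⟩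
    exact ⟨r, hr, s, hs, i, hxr, hys⟩

theorem hasRectangleCover_two_pow_Ncc {X Y : Type} [Finite X] (f : X → Y → Bool) :
    HasRectangleCover f (2 ^ Ncc f) := by
  obtain ⟨P₀, hP₀⟩ := exists_isNondeterministicFor f
  obtain ⟨P, hP, hcost⟩ : Ncc f ∈ {c | ∃ P : RandomizedProtocol X Y,
      P.IsNondeterministicFor f ∧ P.cost = c} := Nat.sInf_mem ⟨_, P₀, hP₀, rfl⟩
  exact hcost ▸ hP.hasRectangleCover

/-- The number `|x ∧ y|` of common ones of two bit strings. -/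
def overlap {n : ℕ} (x y : Fin n → Bool) : ℕ := weight fun i => x i && y i

theorem fNotOne_eq_true_iff {n : ℕ} {x y : Fin n → Bool} :
    fNotOne n x y = true ↔ overlap x y ≠ 1 :=
  decide_eq_true_iff

theorem complementFn_fNotOne_eq_true_iff {n : ℕ} {x y : Fin n → Bool} :
    complementFn (fNotOne n) x y = true ↔ overlap x y = 1 := by
  simp [complementFn, fNotOne, overlap]

theorem overlap_eq_zero_iff {n : ℕ} {x y : Fin n → Bool} :
    overlap x y = 0 ↔ ∀ i, x i = true → y i = false := by
  simp [overlap, weight, Finset.filter_eq_empty_iff]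

theorem overlap_cons {n : ℕ} (a b : Bool) (x y : Fin n → Bool) :
    overlap (Fin.cons a x : Fin (n + 1) → Bool) (Fin.cons b y) = (a && b).toNat + overlap x y := by
  simp only [overlap, weight, Finset.card_filter, Fin.sum_univ_succ, Fin.cons_zero, Fin.cons_succ]
  cases a && b <;> rfl

/-- The bit string marking the positions of the letter `a` in the word `w`. The pairs of bit
strings without a common one are exactly the pairs `(letterIndicator 1 w, letterIndicator 2 w)` of
a word `w` over `Fin 3`, which is how the disjoint pairs are enumerated here. -/
def letterIndicator {α : Type*} [DecidableEq α] {n : ℕ} (a : α) (w : Fin n → α) (i : Fin n) :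
    Bool :=
  decide (w i = a)

theorem letterIndicator_cons {α : Type*} [DecidableEq α] {n : ℕ} (a t : α) (w : Fin n → α) :
    letterIndicator a (Fin.cons t w : Fin (n + 1) → α) =
      Fin.cons (decide (t = a)) (letterIndicator a w) := by
  funext i
  cases i using Fin.cases <;> simp [letterIndicator]

theorem overlap_letterIndicator {α : Type*} [DecidableEq α] {n : ℕ} {a b : α} (hab : a ≠ b)
    (w : Fin n → α) : overlap (letterIndicator a w) (letterIndicator b w) = 0 := by
  simp +contextual [overlap_eq_zero_iff, letterIndicator, hab]

/-- The words over `Fin 3` enumerating the disjoint pairs in the rectangle `A × B`. -/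
def disjointPairs {n : ℕ} (A B : Set (Fin n → Bool)) : Set (Fin n → Fin 3) :=
  letterIndicator 1 ⁻¹' A ∩ letterIndicator 2 ⁻¹' B

theorem disjointPairs_union_left {n : ℕ} (A A' B : Set (Fin n → Bool)) :
    disjointPairs (A ∪ A') B = disjointPairs A B ∪ disjointPairs A' B := by
  rw [disjointPairs, Set.preimage_union, Set.union_inter_distrib_right, disjointPairs,
    disjointPairs]

theorem disjointPairs_union_right {n : ℕ} (A B B' : Set (Fin n → Bool)) :
    disjointPairs A (B ∪ B') = disjointPairs A B ∪ disjointPairs A B' := by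
  rw [disjointPairs, Set.preimage_union, Set.inter_union_distrib_left, disjointPairs,
    disjointPairs]

/-- The section of `S` at the first letter `t`: the words `w` for which `t` followed by `w` lies
in `S`. Inductions on the length of words split `S` into its sections. -/
def consSection {α : Type*} {n : ℕ} (t : α) (S : Set (Fin (n + 1) → α)) : Set (Fin n → α) :=
  {w | (Fin.cons t w : Fin (n + 1) → α) ∈ S}

theorem consSection_disjointPairs {n : ℕ} (t : Fin 3) (A B : Set (Fin (n + 1) → Bool)) :
    consSection t (disjointPairs A B) =
      disjointPairs (consSection (decide (t = 1)) A) (consSection (decide (t = 2)) B) := by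
  ext w
  simp only [consSection, disjointPairs, Set.mem_preimage, Set.mem_inter_iff, Set.mem_ofPred_eq,
    letterIndicator_cons]

theorem ncard_eq_sum_ncard_consSection {α : Type*} [Fintype α] {n : ℕ}
    (S : Set (Fin (n + 1) → α)) : S.ncard = ∑ t, (consSection t S).ncard := by
  classical
  have ncard_eq_sum (m : ℕ) (R : Set (Fin m → α)) :
      R.ncard = ∑ w, if w ∈ R then 1 else 0 := by
    rw [Set.ncard_eq_toFinset_card', ← Finset.card_filter, Set.filter_mem_univ_eq_toFinset]
  simp only [ncard_eq_sum]
  rw [← (Fin.consEquiv fun _ => α).sum_comp, Fintype.sum_prod_type]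
  rfl

theorem ncard_add_ncard_add_ncard_le_of_disjoint {α : Type*} {S T U : Set α} (hS : S.Finite)
    (hT : T.Finite) (hU : U.Finite) (hST : Disjoint S T) :
    U.ncard + S.ncard + T.ncard ≤ (U ∪ S).ncard + (U ∪ T).ncard :=
  calc U.ncard + S.ncard + T.ncard = (S ∪ T).ncard + U.ncard := by
        rw [Set.ncard_union_eq hST hS hT]; ring
    _ ≤ ((U ∪ S) ∪ (U ∪ T)).ncard + ((U ∪ S) ∩ (U ∪ T)).ncard := by
        rw [← Set.union_inter_distrib_left, hST.inter_eq, Set.union_empty]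
        gcongr
        · exact (hU.union hS).union (hU.union hT)
        · exact Set.subset_union_right
        · exact Set.subset_union_right
    _ = (U ∪ S).ncard + (U ∪ T).ncard :=
        Set.ncard_union_add_ncard_inter _ _ (hU.union hS) (hU.union hT)

theorem ncard_disjointPairs_le {n : ℕ} (A B : Set (Fin n → Bool))
    (hAB : ∀ x ∈ A, ∀ y ∈ B, overlap x y ≠ 1) : (disjointPairs A B).ncard ≤ 2 ^ n := by
  induction n with
  | zero => simpa using Set.ncard_le_card (disjointPairs A B)
  | succ n ih =>
    let A' (a : Bool) : Set (Fin n → Bool) := consSection a A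
    let B' (b : Bool) : Set (Fin n → Bool) := consSection b B
    have overlap_ne (a b : Bool) (hab : (a && b) = false) :
        ∀ x ∈ A' a, ∀ y ∈ B' b, overlap x y ≠ 1 := fun x hx y hy => by
      simpa [overlap_cons, hab] using hAB _ hx _ hy
    have hleft : (disjointPairs (A' false ∪ A' true) (B' false)).ncard ≤ 2 ^ n :=
      ih _ _ fun x hx => hx.elim (overlap_ne false false rfl x) (overlap_ne true false rfl x)
    have hright : (disjointPairs (A' false) (B' false ∪ B' true)).ncard ≤ 2 ^ n :=
      ih _ _ fun x hx y hy => hy.elim (overlap_ne false false rfl x hx y)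
        (overlap_ne false true rfl x hx y)
    -- A common word would be a disjoint pair in `A' true × B' true`.
    have hdisj : Disjoint (disjointPairs (A' true) (B' false))
        (disjointPairs (A' false) (B' true)) := by
      refine Set.disjoint_left.2 fun w hw hw' => hAB _ hw.1 _ hw'.2 ?_
      rw [overlap_cons, overlap_letterIndicator (by decide)]
      rfl
    calc (disjointPairs A B).ncard
        = (disjointPairs (A' false) (B' false)).ncard + (disjointPairs (A' true) (B' false)).ncard
          + (disjointPairs (A' false) (B' true)).ncard := by
          rw [ncard_eq_sum_ncard_consSection, Fin.sum_univ_three]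
          simp only [consSection_disjointPairs]
          rfl
      _ ≤ (disjointPairs (A' false ∪ A' true) (B' false)).ncard
          + (disjointPairs (A' false) (B' false ∪ B' true)).ncard := by
          rw [disjointPairs_union_left, disjointPairs_union_right]
          exact ncard_add_ncard_add_ncard_le_of_disjoint (Set.toFinite _) (Set.toFinite _)
            (Set.toFinite _) hdisj
      _ ≤ 2 ^ n + 2 ^ n := Nat.add_le_add hleft hright
      _ = 2 ^ (n + 1) := by rw [pow_succ, mul_two]

theorem three_pow_le_two_pow_Ncc_fNotOne_mul (n : ℕ) : 3 ^ n ≤ 2 ^ Ncc (fNotOne n) * 2 ^ n := by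
  have hcard := (hasRectangleCover_two_pow_Ncc (fNotOne n)).card_le_mul
    (letterIndicator (1 : Fin 3)) (letterIndicator 2)
    (fun w => fNotOne_eq_true_iff.2 (by rw [overlap_letterIndicator (by decide)]; decide)) (2 ^ n)
    fun A B hAB => ncard_disjointPairs_le A B fun x hx y hy =>
      fNotOne_eq_true_iff.1 (hAB x hx y hy)
  simpa using hcard

theorem logb_three_halves_mul_le_Ncc_fNotOne (n : ℕ) :
    Real.logb 2 (3 / 2) * n ≤ Ncc (fNotOne n) := by
  have hpow : (3 / 2 : ℝ) ^ n ≤ 2 ^ Ncc (fNotOne n) := by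
    rw [div_pow, div_le_iff₀ (by positivity)]
    exact_mod_cast three_pow_le_two_pow_Ncc_fNotOne_mul n
  rw [mul_comm, ← Real.logb_pow, Real.logb_le_iff_le_rpow one_lt_two (by positivity)]
  exact_mod_cast hpow

theorem le_Ncc_complementFn_fNotOne_succ (n : ℕ) : n ≤ Ncc (complementFn (fNotOne (n + 1))) := by
  have hval (z z' : Fin n → Bool) : complementFn (fNotOne (n + 1)) (Fin.cons true z)
      (Fin.cons true fun i => !z' i) = true ↔ z ≤ z' := by
    simp [complementFn_fNotOne_eq_true_iff, overlap_cons, overlap_eq_zero_iff, Pi.le_def,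
      Bool.le_iff_imp]
  have hcard := (hasRectangleCover_two_pow_Ncc (complementFn (fNotOne (n + 1)))).card_le_of_fooling
    (fun z : Fin n → Bool => Fin.cons true z) (fun z => Fin.cons true fun i => !z i)
    (fun z => (hval z z).2 le_rfl)
    (fun z z' h h' => le_antisymm ((hval z z').1 h) ((hval z' z).1 h'))
  rw [Fintype.card_fun, Fintype.card_bool, Fintype.card_fin] at hcard
  exact (Nat.pow_le_pow_iff_right one_lt_two).1 hcard

theorem theorem3p6 :
    (∃ c : ℝ, 0 < c ∧ ∃ N : ℕ, ∀ n : ℕ, 1 < n → N ≤ n → c * (n : ℝ) ≤ (Ncc (fNotOne n) : ℝ)) ∧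
    (∀ n : ℕ, 1 < n → (n : ℝ) - 1 ≤ (Ncc (complementFn (fNotOne n)) : ℝ)) := by
  refine ⟨⟨Real.logb 2 (3 / 2), Real.logb_pos one_lt_two (by norm_num), 0,
    fun n _ _ => logb_three_halves_mul_le_Ncc_fNotOne n⟩, fun n hn => ?_⟩
  obtain ⟨m, rfl⟩ := Nat.exists_eq_add_of_lt hn
  have hm := le_Ncc_complementFn_fNotOne_succ (1 + m)
  rw [Nat.cast_add_one, add_sub_cancel_right]
  exact_mod_cast hm
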